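/- Let $0<r<R<\infty$. For each integer $n\ge 0$ let $f_n(x)=J_n(Rx)Y_n(rx)-J_n(rx)Y_n(Rx)$ for $x>0$, where $J_n$ and $Y_n$ are the Bessel functions of the first and second kind of order $n$. Let $g(x)=\bigl(\sqrt{1-x^2}-x\arccos x\bigr)/\pi$ for $0\le x\le 1$, and let $G(x)=R\,g(x/R)-r\,g(x/r)$ for $0\le x\le r$ and $G(x)=R\,g(x/R)$ for $r\le x\le R$. Then for each $n\ge 0$ the positive zeros of $f_n$ form an infinite sequence $0<x_{n,1}<x_{n,2}<\cdots$ (a strictly increasing enumeration of all of them). Moreover there is a constant $C>0$, depending only on $r$ and $R$, such that for every $N\in\mathbb{N}$ there is an integer $K>0$ such that for all integers $0\le n\le N$ and $k\ge K$ one has $n/x_{n,k}\le R$ (so that $G(n/x_{n,k})$ is defined) and $$\left|x_{n,k}\,G\!\left(\frac{n}{x_{n,k}}\right)-k\right|\le \frac{C}{x_{n,k}}.$$ -/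

import Mathlib

open Set MeasureTheory

noncomputable section

namespace BesselCross

/-- The Bessel function of the first kind of integer order `n ≥ 0`,
`J_n(x) = π⁻¹ ∫₀^π cos (x sin θ - n θ) dθ`. -/
def besselJ (n : ℕ) (x : ℝ) : ℝ :=
  (1 / Real.pi) * ∫ θ in (0 : ℝ)..Real.pi, Real.cos (x * Real.sin θ - n * θ)

/-- The Bessel function of the second kind of integer order `n ≥ 0`, for `x > 0`:
`Y_n(x) = π⁻¹ ∫₀^π sin (x sin θ - n θ) dθ
  - π⁻¹ ∫₀^∞ (exp (n t) + exp (-n t) cos (n π)) exp (-x sinh t) dt`.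
(For `x ≤ 0` the second integral diverges and the value is irrelevant.) -/
def besselY (n : ℕ) (x : ℝ) : ℝ :=
  (1 / Real.pi) * (∫ θ in (0 : ℝ)..Real.pi, Real.sin (x * Real.sin θ - n * θ)) -
    (1 / Real.pi) * ∫ t in Ioi (0 : ℝ),
      (Real.exp (n * t) + Real.exp (-(n * t)) * Real.cos (n * Real.pi)) *
        Real.exp (-(x * Real.sinh t))

/-- The cross-product `f_n(x) = J_n(R x) Y_n(r x) - J_n(r x) Y_n(R x)`. -/
def crossProduct (r R : ℝ) (n : ℕ) (x : ℝ) : ℝ :=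
  besselJ n (R * x) * besselY n (r * x) - besselJ n (r * x) * besselY n (R * x)

/-- `g(x) = (√(1 - x²) - x arccos x) / π`, used for `0 ≤ x ≤ 1`. -/
def gFun (x : ℝ) : ℝ :=
  (Real.sqrt (1 - x ^ 2) - x * Real.arccos x) / Real.pi

/-- `G(x) = R g(x / R) - r g(x / r)` for `0 ≤ x ≤ r` and `G(x) = R g(x / R)` for `r ≤ x ≤ R`;
the two formulas agree at `x = r` because `g(1) = 0`. Used for `0 ≤ x ≤ R`. -/
def GFun (r R x : ℝ) : ℝ :=
  if x ≤ r then R * gFun (x / R) - r * gFun (x / r) else R * gFun (x / R)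

/-- `x 1 < x 2 < x 3 < ⋯` is the increasing enumeration of all positive zeros of `f`
(the value `x 0` plays no role). -/
structure IsPosZeroSeq (f : ℝ → ℝ) (x : ℕ → ℝ) : Prop where
  strictMonoOn : StrictMonoOn x (Ici 1)
  image_eq : x '' Ici 1 = {t : ℝ | 0 < t ∧ f t = 0}

end BesselCross

end

/-!
Both functions `J_n` and `Y_n` solve Bessel's equation `t² u'' + t u' + (t² - n²) u = 0` on
`t > 0`, which is read off from their integral representations, and they are linearly
independent. Nothing finer about them is used except that `Y_n → -∞` at `0+`; in particular no
asymptotic expansion of `J_n` or `Y_n` at infinity enters.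

Fix `n`, let `W` be the constant `t (J Y' - J' Y)` and let
`u_a(t) = (J(a) Y(t) - J(t) Y(a)) / W`, the solution with `u_a(a) = 0`, `u_a'(a) = 1 / a`. Then
`f_n(x) = 0` if and only if `u_{rx}(Rx) = 0`. Since `√t u_a` solves `w'' + (1 - μ / t²) w = 0`
with `μ = n² - 1/4`, its Prüfer angle `ψ`, normalised by `ψ(a) = 0`, satisfies
`ψ' = 1 - (μ / t²) sin² ψ`, and `f_n(x) = 0` exactly when `Φ(x) = ψ(Rx)` with `a = rx` is an
integral multiple of `π`.

* *Numbering of the zeros.* `Φ` is continuous and lies in `(0, π)` near `0`, because `J / Y` is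
  injective near `0`, where `Y < 0`. It tends to infinity, and it crosses every level `k π` upwards only:
  at a zero of `f_n` the derivative of `x ↦ u_{rx}(Rx)` has the sign of `u_a'(b)`, `b = Rx`, as
  soon as `b² u_a'(b)² > 1 = a² u_a'(a)²`, and this holds because `t² u'² + (t² - n²) u²` has
  derivative `2 t u²` (`IsFundamentalPair.prueferAngle_upcrossing`). So the `k`-th positive zero
  is the unique point with `Φ(x) = k π` (`exists_enumeration_of_upcrossing`).
* *Size of the angle.* Replacing `sin² ψ` by its mean `1/2` costs only `O(x⁻²)`, since the
  oscillating part can be integrated (`pruefer_angle_estimate`), so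
  `Φ(x) = (R - r) x + (μ / 2) (1 / R - 1 / r) / x + O(x⁻²)`.
* *Comparison.* Expanding `g` at `0` gives
  `π x G(n / x) = (R - r) x + (n² / 2) (1 / R - 1 / r) / x + O(x⁻²)` (`GFun_expansion`). At the
  `k`-th zero the terms with `n²` cancel, and `π (x G(n / x) - k)` equals
  `-(1 / r - 1 / R) / (8 x) + O(x⁻²)`. Only the `O(x⁻²)` term depends on `n`, which is why `C`
  can be chosen independently of `N`.
-/

namespace BesselCross

open Filter Topology Real Asymptotics

/-! ### Upward crossings, Prüfer angles and the expansion of `g` -/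

/-- A continuous function which crosses the level `c` only upwards stays above `c` once it has reached
it. -/
lemma lt_of_upcrossing {φ : ℝ → ℝ} {c : ℝ} (hφ : ContinuousOn φ (Ioi 0))
    (hup : ∀ x₀ > 0, φ x₀ = c → ∀ᶠ x in 𝓝 x₀, (x < x₀ → φ x < c) ∧ (x₀ < x → c < φ x))
    {x₀ x₁ : ℝ} (h₀ : 0 < x₀) (h₀₁ : x₀ < x₁) (hc : c ≤ φ x₀) : c < φ x₁ := by
  -- A point with `φ < c` to the right of `x₀` is excluded first.
  have key : ∀ y, x₀ < y → c ≤ φ y := by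
    intro y hy
    by_contra! hlt
    have hcont : ContinuousOn φ (Icc x₀ y) := hφ.mono fun t ht => h₀.trans_le ht.1
    have hcl : IsCompact (Icc x₀ y ∩ φ ⁻¹' Ici c) :=
      isCompact_Icc.of_isClosed_subset
        (hcont.preimage_isClosed_of_isClosed isClosed_Icc isClosed_Ici) inter_subset_left
    obtain ⟨s, ⟨hs, hsc⟩, hmax⟩ := hcl.exists_isGreatest ⟨x₀, ⟨le_rfl, hy.le⟩, hc⟩
    have hs0 : 0 < s := h₀.trans_le hs.1
    have hsy : s < y := by
      rcases hs.2.lt_or_eq with h | h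
      · exact h
      · rw [h] at hsc
        exact absurd hlt (not_lt.2 hsc)
    have hlt' : ∀ᶠ t in 𝓝[>] s, φ t < c := by
      filter_upwards [Ioo_mem_nhdsGT hsy] with t ht
      by_contra! h
      exact absurd (hmax ⟨⟨hs.1.trans ht.1.le, ht.2.le⟩, h⟩) (not_le.2 ht.1)
    have hle : φ s ≤ c :=
      le_of_tendsto (((hφ s hs0).continuousAt (Ioi_mem_nhds hs0)).tendsto.mono_left
        nhdsWithin_le_nhds) (hlt'.mono fun _ h => h.le)
    have hgt := (hup s hs0 (le_antisymm hle hsc)).filter_mono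
      (nhdsWithin_le_nhds (s := Ioi s))
    obtain ⟨t, h1, h2, h3⟩ := (hlt'.and (hgt.and self_mem_nhdsWithin)).exists
    exact lt_asymm h1 (h2.2 h3)
  rcases (key x₁ h₀₁).lt_or_eq with h | h
  · exact h
  · have hlt := (hup x₁ (h₀.trans h₀₁) h.symm).filter_mono
      (nhdsWithin_le_nhds (s := Iio x₁))
    obtain ⟨t, ⟨h1, -⟩, h2, h3⟩ := (hlt.and ((Ioo_mem_nhdsLT h₀₁ :
      ∀ᶠ t in 𝓝[<] x₁, t ∈ Ioo x₀ x₁))).exists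
    exact absurd (h1 h3) (not_lt.2 (key t h2))

/-- A continuous `φ` on `(0, ∞)` which starts in `(0, π)`, tends to infinity and crosses the levels
`k π` only upwards takes each value `k π` with `k ≥ 1` exactly once and no other multiple of `π`;
the points where this happens are increasing in `k`. -/
lemma exists_enumeration_of_upcrossing {φ : ℝ → ℝ} (hφ : ContinuousOn φ (Ioi 0))
    (hup : ∀ x₀ > 0, ∀ k : ℤ, φ x₀ = k * π →
      ∀ᶠ x in 𝓝 x₀, (x < x₀ → φ x < k * π) ∧ (x₀ < x → k * π < φ x))
    {δ : ℝ} (hδ : 0 < δ) (hsmall : ∀ x, 0 < x → x < δ → 0 < φ x ∧ φ x < π)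
    (htop : Tendsto φ atTop atTop) :
    ∃ x : ℕ → ℝ, StrictMonoOn x (Ici 1) ∧
      x '' Ici 1 = {t : ℝ | 0 < t ∧ ∃ k : ℤ, φ t = k * π} ∧
      (∀ k, 1 ≤ k → φ (x k) = k * π) ∧ Tendsto x atTop atTop := by
  have cross : ∀ (k : ℤ) {x₀ x₁ : ℝ}, 0 < x₀ → x₀ < x₁ → k * π ≤ φ x₀ → k * π < φ x₁ :=
    fun k x₀ x₁ h₀ h h' => lt_of_upcrossing hφ (fun y hy hk => hup y hy k hk) h₀ h h'
  have hpos : ∀ x, 0 < x → 0 < φ x := by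
    intro x hx
    by_cases h : x < δ
    · exact (hsmall x hx h).1
    · have := cross 0 (half_pos hδ) (show δ / 2 < x by linarith)
        (by simpa using (hsmall _ (half_pos hδ) (by linarith)).1.le)
      simpa using this
  have hex : ∀ k : ℕ, 1 ≤ k → ∃ x, 0 < x ∧ φ x = k * π := by
    intro k hk
    obtain ⟨b, hb, hbδ⟩ := ((htop.eventually_ge_atTop (k * π)).and
      (eventually_ge_atTop δ)).exists
    have hk' : (1 : ℝ) ≤ k := by exact_mod_cast hk
    have h2 := (hsmall _ (half_pos hδ) (by linarith)).2
    have hsub : Icc (δ / 2) b ⊆ Ioi 0 := fun t ht => (half_pos hδ).trans_le ht.1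
    obtain ⟨x, hx, hxk⟩ := intermediate_value_Icc (by linarith) (hφ.mono hsub)
      (show (k : ℝ) * π ∈ Icc _ _ from ⟨by nlinarith [pi_pos], hb⟩)
    exact ⟨x, hsub hx, hxk⟩
  choose! x hx0 hxk using hex
  have hord : ∀ j : ℕ, 1 ≤ j → ∀ t : ℝ, 0 < t → φ t < j * π → t < x j := by
    intro j hj t ht hlt
    by_contra! hle
    rcases hle.lt_or_eq with h | h
    · have := cross j (hx0 j hj) h (by rw [hxk j hj]; simp)
      push_cast at this
      exact lt_asymm hlt this
    · rw [← h, hxk j hj] at hlt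
      exact lt_irrefl _ hlt
  refine ⟨x, ?_, ?_, hxk, ?_⟩
  · intro j hj k hk hjk
    refine hord k hk _ (hx0 j hj) ?_
    rw [hxk j hj]
    exact mul_lt_mul_of_pos_right (by exact_mod_cast hjk) pi_pos
  · ext t
    constructor
    · rintro ⟨k, hk, rfl⟩
      exact ⟨hx0 k hk, k, by simpa using hxk k hk⟩
    · rintro ⟨ht, k, hk⟩
      have hkpos : 0 < k := by
        have h := hpos t ht
        rw [hk] at h
        exact_mod_cast pos_of_mul_pos_left h pi_pos.le
      lift k to ℕ using hkpos.le
      have hk1 : 1 ≤ k := by exact_mod_cast hkpos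
      refine ⟨k, hk1, ?_⟩
      push_cast at hk
      rcases lt_trichotomy (x k) t with h | h | h
      · have := cross k (hx0 k hk1) h (by rw [hxk k hk1]; simp)
        push_cast at this
        exact absurd hk this.ne'
      · exact h
      · have := cross k ht h (by rw [hk]; simp)
        push_cast at this
        exact absurd (hxk k hk1) this.ne'
  · refine tendsto_atTop.2 fun M => ?_
    obtain ⟨m, hm⟩ := exists_nat_gt (φ (max M 1) / π)
    filter_upwards [eventually_ge_atTop (max m 1)] with k hk
    have h1 : φ (max M 1) < k * π := by
      rw [div_lt_iff₀ pi_pos] at hm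
      refine hm.trans_le (mul_le_mul_of_nonneg_right ?_ pi_pos.le)
      exact_mod_cast (le_max_left _ _).trans hk
    exact (le_max_left _ _).trans
      (hord k ((le_max_right _ _).trans hk) _ (by positivity) h1).le

/-- If `ψ` moves with the angular speed of the plane curve `(q, p)` and starts at its polar angle,
then it is a polar angle of that curve throughout. -/
lemma polar_of_hasDerivAt {p q p' q' ψ : ℝ → ℝ} {a : ℝ} (ha : 0 < a)
    (hp : ∀ t > 0, HasDerivAt p (p' t) t) (hq : ∀ t > 0, HasDerivAt q (q' t) t)
    (hne : ∀ t > 0, 0 < p t ^ 2 + q t ^ 2)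
    (hψ : ∀ t > 0, HasDerivAt ψ ((p' t * q t - p t * q' t) / (p t ^ 2 + q t ^ 2)) t)
    (hpa : p a = 0) (hqa : 0 < q a) (hψa : ψ a = 0) {t : ℝ} (ht : 0 < t) :
    p t = √(p t ^ 2 + q t ^ 2) * sin (ψ t) ∧ q t = √(p t ^ 2 + q t ^ 2) * cos (ψ t) := by
  set ρ : ℝ → ℝ := fun t => √(p t ^ 2 + q t ^ 2) with hρdef
  have hρpos : ∀ t > 0, 0 < ρ t := fun t ht => sqrt_pos.2 (hne t ht)
  have hρsq : ∀ t > 0, ρ t ^ 2 = p t ^ 2 + q t ^ 2 := fun t ht => sq_sqrt (hne t ht).le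
  have hρ : ∀ t > 0, HasDerivAt ρ ((p t * p' t + q t * q' t) / ρ t) t := by
    intro t ht
    have h := (((hp t ht).pow 2).add ((hq t ht).pow 2)).sqrt (hne t ht).ne'
    refine h.congr_deriv ?_
    have := (hρpos t ht).ne'
    change _ / (2 * ρ t) = _
    field_simp
    simp
    ring
  -- The unit vector `(p, q) / ρ` and `(sin ψ, cos ψ)` rotate with the same speed.
  have hP : ∀ t > 0, HasDerivAt (fun t => p t / ρ t)
      ((p' t * q t - p t * q' t) / (p t ^ 2 + q t ^ 2) * (q t / ρ t)) t := by
    intro t ht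
    refine ((hp t ht).div (hρ t ht) (hρpos t ht).ne').congr_deriv ?_
    have h1 := (hρpos t ht).ne'
    rw [← hρsq t ht]
    field_simp
    rw [hρsq t ht]; ring
  have hQ : ∀ t > 0, HasDerivAt (fun t => q t / ρ t)
      (-((p' t * q t - p t * q' t) / (p t ^ 2 + q t ^ 2) * (p t / ρ t))) t := by
    intro t ht
    refine ((hq t ht).div (hρ t ht) (hρpos t ht).ne').congr_deriv ?_
    have h1 := (hρpos t ht).ne'
    rw [← hρsq t ht]
    field_simp
    rw [hρsq t ht]; ring
  have hconst : ∀ F : ℝ → ℝ, (∀ t > 0, HasDerivAt F 0 t) → F t = F a := fun F hF =>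
    isOpen_Ioi.is_const_of_deriv_eq_zero isPreconnected_Ioi
      (fun s hs => (hF s hs).differentiableAt.differentiableWithinAt)
      (fun s hs => (hF s hs).deriv) ht ha
  have hρa : ρ a = q a := by simp [hρdef, hpa, sqrt_sq hqa.le]
  have hD := hconst (fun t => p t / ρ t * cos (ψ t) - q t / ρ t * sin (ψ t)) fun t ht => by
    refine (((hP t ht).mul (hψ t ht).cos).sub ((hQ t ht).mul (hψ t ht).sin)).congr_deriv ?_
    ring
  have hS := hconst (fun t => p t / ρ t * sin (ψ t) + q t / ρ t * cos (ψ t)) fun t ht => by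
    refine (((hP t ht).mul (hψ t ht).sin).add ((hQ t ht).mul (hψ t ht).cos)).congr_deriv ?_
    ring
  simp only [hpa, hψa, hρa, div_self hqa.ne', sin_zero, cos_zero] at hD hS
  have hsc := sin_sq_add_cos_sq (ψ t)
  have h1 : p t / ρ t = sin (ψ t) := by
    linear_combination cos (ψ t) * hD + sin (ψ t) * hS - p t / ρ t * hsc
  have h2 : q t / ρ t = cos (ψ t) := by
    linear_combination cos (ψ t) * hS - sin (ψ t) * hD - q t / ρ t * hsc
  rw [div_eq_iff (hρpos t ht).ne'] at h1 h2
  exact ⟨h1.trans (mul_comm _ _), h2.trans (mul_comm _ _)⟩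

/-- The Prüfer angle of `w'' + (1 - μ / t²) w = 0`: in `ψ' = 1 - μ / (2 t²) + μ cos (2 ψ) / (2 t²)` the
last term contributes only to higher order, because it is, up to `O(t⁻³)`, the derivative of
`μ sin (2 ψ) / (4 t²)`. -/
lemma pruefer_angle_estimate {ψ : ℝ → ℝ} {μ a b : ℝ} (ha : 0 < a) (hab : a ≤ b)
    (hψ : ∀ t > 0, HasDerivAt ψ (1 - μ / t ^ 2 * sin (ψ t) ^ 2) t) (hψa : ψ a = 0) :
    |ψ b - (b - a) - μ / 2 * (1 / b - 1 / a)| ≤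
      |μ| / 2 * (|μ| / a ^ 4 + 1 / a ^ 3) * (b - a) + |μ| / 4 / b ^ 2 := by
  have hb : 0 < b := ha.trans_le hab
  -- Subtracting primitives of all terms of `ψ'` down to order `t⁻²` leaves a derivative `O(t⁻³)`.
  set E : ℝ → ℝ := fun t => ψ t - t - μ / 2 * t⁻¹ - μ / 4 * (sin (2 * ψ t) * (t ^ 2)⁻¹) with hE
  have hEd : ∀ t > 0, HasDerivAt E
      (μ / 2 * (cos (2 * ψ t) * (μ * sin (ψ t) ^ 2) / t ^ 4 + sin (2 * ψ t) / t ^ 3)) t := by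
    intro t ht
    have h := (((hψ t ht).sub (hasDerivAt_id t)).sub ((hasDerivAt_inv ht.ne').const_mul (μ / 2))).sub
      (((((hψ t ht).const_mul 2).sin).mul
        (((hasDerivAt_pow 2 t)).inv (pow_ne_zero 2 ht.ne'))).const_mul (μ / 4))
    refine h.congr_deriv ?_
    have hc : sin (ψ t) ^ 2 = (1 - cos (2 * ψ t)) / 2 := by rw [sin_sq_eq_half_sub]; ring
    simp only [Pi.inv_apply]
    rw [hc]
    field_simp
    ring
  have hbound : ∀ t ∈ Icc a b, ‖μ / 2 * (cos (2 * ψ t) * (μ * sin (ψ t) ^ 2) / t ^ 4 +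
      sin (2 * ψ t) / t ^ 3)‖ ≤ |μ| / 2 * (|μ| / a ^ 4 + 1 / a ^ 3) := by
    intro t ht
    have ht0 : 0 < t := ha.trans_le ht.1
    rw [norm_eq_abs, abs_mul, abs_div, abs_two]
    refine mul_le_mul_of_nonneg_left ?_ (by positivity)
    refine (abs_add_le _ _).trans (add_le_add ?_ ?_)
    · rw [abs_div, abs_mul, abs_mul, abs_of_pos (pow_pos ht0 4),
        abs_of_nonneg (sq_nonneg (sin (ψ t)))]
      have h1 : |cos (2 * ψ t)| * (|μ| * sin (ψ t) ^ 2) ≤ 1 * (|μ| * 1) := by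
        gcongr
        · exact abs_cos_le_one _
        · exact sin_sq_le_one _
      rw [one_mul, mul_one] at h1
      have := ht.1
      gcongr
    · rw [abs_div, abs_of_pos (pow_pos ht0 3)]
      have := ht.1
      have := abs_sin_le_one (2 * ψ t)
      gcongr
  have hmv := (convex_Icc a b).norm_image_sub_le_of_norm_hasDerivWithin_le
    (fun t ht => (hEd t (ha.trans_le ht.1)).hasDerivWithinAt) hbound
    (left_mem_Icc.2 hab) (right_mem_Icc.2 hab)
  rw [norm_eq_abs, norm_eq_abs, abs_of_nonneg (sub_nonneg.2 hab)] at hmv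
  have hEq : ψ b - (b - a) - μ / 2 * (1 / b - 1 / a) =
      (E b - E a) + μ / 4 * sin (2 * ψ b) / b ^ 2 := by
    simp only [hE, hψa]
    simp
    ring
  rw [hEq]
  refine (abs_add_le _ _).trans (add_le_add hmv ?_)
  rw [abs_div, abs_mul, abs_div, abs_of_pos (pow_pos hb 2), abs_of_pos (by norm_num : (0:ℝ) < 4)]
  have := abs_sin_le_one (2 * ψ b)
  gcongr
  exact mul_le_of_le_one_right (by positivity) this

/-- Taylor expansion of `π g` at `0`, obtained from `π g(sin v) = cos v + v sin v - (π / 2) sin v`. -/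
lemma gFun_expansion {u : ℝ} (h0 : 0 ≤ u) (h1 : u ≤ 1 / 2) :
    |π * gFun u - (1 - π / 2 * u + u ^ 2 / 2)| ≤ 8 * u ^ 3 := by
  set v := arcsin u with hv
  have hu : sin v = u := sin_arcsin (by linarith) (by linarith)
  have hv0 : 0 ≤ v := arcsin_nonneg.2 h0
  have hvu : v ≤ 2 * u := by
    have hle := mul_le_sin hv0 (arcsin_le_pi_div_two u)
    rw [hu] at hle
    have : 2 / π * v ≥ 2 / 4 * v := by
      gcongr
      exact pi_le_four
    linarith
  have hv1 : v ≤ 1 := by linarith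
  have hg : π * gFun u = cos v + v * u - π / 2 * u := by
    rw [gFun, mul_div_cancel₀ _ pi_ne_zero, ← cos_arcsin, arccos_eq_pi_div_two_sub_arcsin]
    ring
  have hc := cos_bound (x := v) (by rw [abs_of_nonneg hv0]; exact hv1)
  have hs := sin_bound (x := v) (by rw [abs_of_nonneg hv0]; exact hv1)
  rw [abs_of_nonneg hv0, abs_le] at hc hs
  rw [hu] at hs
  have h3 : v ^ 3 ≤ 8 * u ^ 3 := by
    calc v ^ 3 ≤ (2 * u) ^ 3 := by gcongr
      _ = 8 * u ^ 3 := by ring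
  have h4 : v ^ 4 ≤ v ^ 3 := pow_le_pow_of_le_one hv0 hv1 (by norm_num)
  -- With `e = v - u` the quantity is `cos v - 1 + v² / 2 - e² / 2`.
  have he0 : 0 ≤ v - u := by rw [← hu]; linarith [sin_le hv0]
  have he1 : v - u ≤ v ^ 3 / 4 := by nlinarith
  have hv3 : v ^ 3 ≤ 1 := pow_le_one₀ hv0 hv1
  have he2 : (v - u) ^ 2 ≤ v ^ 3 / 4 := by nlinarith [pow_nonneg hv0 3]
  rw [hg, abs_le]
  constructor <;> nlinarith [pow_nonneg hv0 3]

/-! ### Solutions of Bessel's equation that vanish at a given point -/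

/-- `u` solves Bessel's equation of order `n` on `(0, ∞)`, with derivative `u'`. -/
structure IsBesselSol (n : ℝ) (u u' : ℝ → ℝ) : Prop where
  hasDerivAt : ∀ t > 0, HasDerivAt u (u' t) t
  hasDerivAt_deriv : ∀ t > 0, HasDerivAt u' (-(u' t) / t - (1 - n ^ 2 / t ^ 2) * u t) t

/-- `J` and `Y`, with derivatives `J'` and `Y'`, are linearly independent solutions of Bessel's
equation of order `n` on `(0, ∞)`; `W` is the constant value of `t` times their Wronskian. -/
structure IsFundamentalPair (n W : ℝ) (J J' Y Y' : ℝ → ℝ) : Prop where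
  left : IsBesselSol n J J'
  right : IsBesselSol n Y Y'
  wronskian : ∀ t > 0, t * (J t * Y' t - J' t * Y t) = W
  ne_zero : W ≠ 0

lemma IsBesselSol.wronskian_const {n : ℝ} {J J' Y Y' : ℝ → ℝ} (hJ : IsBesselSol n J J')
    (hY : IsBesselSol n Y Y') {s t : ℝ} (hs : 0 < s) (ht : 0 < t) :
    s * (J s * Y' s - J' s * Y s) = t * (J t * Y' t - J' t * Y t) := by
  have h : ∀ t > 0, HasDerivAt (fun t => t * (J t * Y' t - J' t * Y t)) 0 t := by
    intro t ht
    refine ((hasDerivAt_id t).mul (((hJ.hasDerivAt t ht).mul (hY.hasDerivAt_deriv t ht)).sub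
      ((hJ.hasDerivAt_deriv t ht).mul (hY.hasDerivAt t ht)))).congr_deriv ?_
    simp only [id, Pi.sub_apply, Pi.mul_apply]
    field_simp
    ring
  exact isOpen_Ioi.is_const_of_deriv_eq_zero isPreconnected_Ioi
      (fun s hs => (h s hs).differentiableAt.differentiableWithinAt)
      (fun s hs => (h s hs).deriv) hs ht

/-- Between two zeros `a < b` of a nontrivial solution the quantity `t² u'²` grows, because
`t² u'² + (t² - n²) u²` has derivative `2 t u²`. -/
lemma IsBesselSol.energy_lt {n : ℝ} {u u' : ℝ → ℝ} (h : IsBesselSol n u u') {a b : ℝ}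
    (ha : 0 < a) (hab : a < b) (hua : u a = 0) (hub : u b = 0) (hu' : u' a ≠ 0) :
    a ^ 2 * u' a ^ 2 < b ^ 2 * u' b ^ 2 := by
  set E : ℝ → ℝ := fun t => t ^ 2 * u' t ^ 2 + (t ^ 2 - n ^ 2) * u t ^ 2 with hE
  have hd : ∀ t > 0, HasDerivAt E (2 * t * u t ^ 2) t := by
    intro t ht
    refine (((hasDerivAt_pow 2 t).mul ((h.hasDerivAt_deriv t ht).pow 2)).add
      (((hasDerivAt_pow 2 t).sub_const (n ^ 2)).mul ((h.hasDerivAt t ht).pow 2))).congr_deriv ?_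
    simp only [Pi.pow_apply]
    field_simp
    ring
  have hmono : MonotoneOn E (Icc a b) := by
    refine monotoneOn_of_hasDerivWithinAt_nonneg (convex_Icc a b)
      (fun t ht => (hd t (ha.trans_le ht.1)).continuousAt.continuousWithinAt)
      (fun t ht => (hd t (ha.trans_le (interior_subset ht).1)).hasDerivWithinAt) fun t ht => ?_
    have := ha.trans_le (interior_subset ht).1
    positivity
  have hEa : E a = a ^ 2 * u' a ^ 2 := by simp [hE, hua]
  have hEb : E b = b ^ 2 * u' b ^ 2 := by simp [hE, hub]
  rw [← hEa, ← hEb]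
  refine (hmono (left_mem_Icc.2 hab.le) (right_mem_Icc.2 hab.le) hab.le).lt_of_ne fun heq => ?_
  -- If the energy were constant, `u` would vanish to the right of `a`.
  have hne : ∀ᶠ t in 𝓝[>] a, u t ≠ 0 := by
    have := (h.hasDerivAt a ha).eventually_ne (c := 0) hu'
    exact this.filter_mono (nhdsWithin_mono _ fun t ht => ne_of_gt ht)
  obtain ⟨c, hc0, hc⟩ := (hne.and (Ioo_mem_nhdsGT hab)).exists
  have hconst : E =ᶠ[𝓝 c] fun _ => E a := by
    filter_upwards [Ioo_mem_nhds hc.1 hc.2] with t ht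
    have ht' : t ∈ Icc a b := Ioo_subset_Icc_self ht
    exact le_antisymm (heq ▸ hmono ht' (right_mem_Icc.2 hab.le) ht.2.le)
      (hmono (left_mem_Icc.2 hab.le) ht' ht.1.le)
  have h0 := (hd c (ha.trans hc.1)).unique ((hasDerivAt_const c (E a)).congr_of_eventuallyEq hconst)
  have : 0 < c := ha.trans hc.1
  have : 0 < 2 * c * u c ^ 2 := by positivity
  exact this.ne' h0

/-- The solution of Bessel's equation in `t` which vanishes at `a` and, if `W` is `t` times the
Wronskian of `J` and `Y`, has derivative `1 / a` there. -/
noncomputable def kernel (W : ℝ) (J Y : ℝ → ℝ) (a t : ℝ) : ℝ := (J a * Y t - J t * Y a) / W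

/-- The derivative of `kernel W J Y a t` in `t`. -/
noncomputable def kernelDeriv (W : ℝ) (J J' Y Y' : ℝ → ℝ) (a t : ℝ) : ℝ :=
  (J a * Y' t - J' t * Y a) / W

/-- With `w = √t u` for `u = kernel W J Y a`, the derivative of the polar angle of `(w', w)`. Both
coordinates are divided by `√t`, so that the curve is `(u / (2 t) + u', u)`. -/
noncomputable def angularSpeed (n W : ℝ) (J J' Y Y' : ℝ → ℝ) (a t : ℝ) : ℝ :=
  ((kernel W J Y a t / (2 * t) + kernelDeriv W J J' Y Y' a t) ^ 2 +
      (1 - (n ^ 2 - 1 / 4) / t ^ 2) * kernel W J Y a t ^ 2) /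
    (kernel W J Y a t ^ 2 + (kernel W J Y a t / (2 * t) + kernelDeriv W J J' Y Y' a t) ^ 2)

/-- The Prüfer angle at `b` of `√t` times `kernel W J Y a`, normalised to vanish at `a`. -/
noncomputable def prueferAngle (n W : ℝ) (J J' Y Y' : ℝ → ℝ) (a b : ℝ) : ℝ :=
  ∫ t in a..b, angularSpeed n W J J' Y Y' a t

namespace IsFundamentalPair

variable {n W : ℝ} {J J' Y Y' : ℝ → ℝ}

lemma isBesselSol_kernel (h : IsFundamentalPair n W J J' Y Y') (a : ℝ) :
    IsBesselSol n (kernel W J Y a) (kernelDeriv W J J' Y Y' a) := by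
  constructor
  · intro t ht
    exact (((h.right.hasDerivAt t ht).const_mul (J a)).sub
      ((h.left.hasDerivAt t ht).mul_const (Y a))).div_const W
  · intro t ht
    refine ((((h.right.hasDerivAt_deriv t ht).const_mul (J a)).sub
      ((h.left.hasDerivAt_deriv t ht).mul_const (Y a))).div_const W).congr_deriv ?_
    simp only [kernel, kernelDeriv]
    ring

lemma kernel_self (a : ℝ) : kernel W J Y a a = 0 := by simp [kernel]

lemma kernelDeriv_self (h : IsFundamentalPair n W J J' Y Y') {a : ℝ} (ha : 0 < a) :
    kernelDeriv W J J' Y Y' a a = 1 / a := by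
  rw [kernelDeriv, ← h.wronskian a ha]
  have h1 : J a * Y' a - J' a * Y a ≠ 0 := fun h0 => h.ne_zero (by rw [← h.wronskian a ha, h0]; simp)
  field_simp

lemma normSq_pos (h : IsFundamentalPair n W J J' Y Y') {a t : ℝ} (ha : 0 < a) (ht : 0 < t) :
    0 < kernel W J Y a t ^ 2 +
      (kernel W J Y a t / (2 * t) + kernelDeriv W J J' Y Y' a t) ^ 2 := by
  by_contra! hle
  have h1 : kernel W J Y a t = 0 := by
    nlinarith only [hle, sq_nonneg (kernel W J Y a t),
      sq_nonneg (kernel W J Y a t / (2 * t) + kernelDeriv W J J' Y Y' a t)]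
  have h2 : kernelDeriv W J J' Y Y' a t = 0 := by
    rw [h1] at hle
    simp only [zero_div, zero_add] at hle
    nlinarith [sq_nonneg (kernelDeriv W J J' Y Y' a t)]
  simp only [kernel, kernelDeriv, div_eq_zero_iff, h.ne_zero, or_false] at h1 h2
  have hw := h.wronskian t ht
  have hJ : J a * W = 0 := by rw [← hw]; linear_combination t * (J t * h2 - J' t * h1)
  have hY : Y a * W = 0 := by rw [← hw]; linear_combination t * (Y t * h2 - Y' t * h1)
  have hJa := (mul_eq_zero.1 hJ).resolve_right h.ne_zero
  have hYa := (mul_eq_zero.1 hY).resolve_right h.ne_zero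
  exact h.ne_zero (by rw [← h.wronskian a ha, hJa, hYa]; ring)

lemma continuousOn_angularSpeed (h : IsFundamentalPair n W J J' Y Y') :
    ContinuousOn (fun p : ℝ × ℝ => angularSpeed n W J J' Y Y' p.1 p.2) (Ioi 0 ×ˢ Ioi 0) := by
  have c1 : ∀ {f : ℝ → ℝ}, ContinuousOn f (Ioi 0) →
      ContinuousOn (fun p : ℝ × ℝ => f p.1) (Ioi 0 ×ˢ Ioi 0) :=
    fun hf => hf.comp continuousOn_fst fun p hp => hp.1
  have c2 : ∀ {f : ℝ → ℝ}, ContinuousOn f (Ioi 0) →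
      ContinuousOn (fun p : ℝ × ℝ => f p.2) (Ioi 0 ×ˢ Ioi 0) :=
    fun hf => hf.comp continuousOn_snd fun p hp => hp.2
  have hJ : ContinuousOn J (Ioi 0) :=
    fun t ht => (h.left.hasDerivAt t ht).continuousAt.continuousWithinAt
  have hJ' : ContinuousOn J' (Ioi 0) :=
    fun t ht => (h.left.hasDerivAt_deriv t ht).continuousAt.continuousWithinAt
  have hY : ContinuousOn Y (Ioi 0) :=
    fun t ht => (h.right.hasDerivAt t ht).continuousAt.continuousWithinAt
  have hY' : ContinuousOn Y' (Ioi 0) :=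
    fun t ht => (h.right.hasDerivAt_deriv t ht).continuousAt.continuousWithinAt
  have hk : ContinuousOn (fun p : ℝ × ℝ => kernel W J Y p.1 p.2) (Ioi 0 ×ˢ Ioi 0) :=
    (((c1 hJ).mul (c2 hY)).sub ((c2 hJ).mul (c1 hY))).div_const W
  have hk' : ContinuousOn (fun p : ℝ × ℝ => kernelDeriv W J J' Y Y' p.1 p.2) (Ioi 0 ×ˢ Ioi 0) :=
    (((c1 hJ).mul (c2 hY')).sub ((c2 hJ').mul (c1 hY))).div_const W
  have hq : ContinuousOn (fun p : ℝ × ℝ => kernel W J Y p.1 p.2 / (2 * p.2) +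
      kernelDeriv W J J' Y Y' p.1 p.2) (Ioi 0 ×ˢ Ioi 0) :=
    (hk.div (continuousOn_const.mul continuousOn_snd)
      fun p hp => mul_ne_zero two_ne_zero (ne_of_gt hp.2)).add hk'
  refine ((hq.pow 2).add ((continuousOn_const.sub (continuousOn_const.div (continuousOn_snd.pow 2)
    fun p hp => pow_ne_zero 2 (ne_of_gt hp.2))).mul (hk.pow 2))).div ((hk.pow 2).add (hq.pow 2))
    fun p hp => (h.normSq_pos hp.1 hp.2).ne'

lemma hasDerivAt_prueferAngle (h : IsFundamentalPair n W J J' Y Y') {a t : ℝ}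
    (ha : 0 < a) (ht : 0 < t) :
    HasDerivAt (prueferAngle n W J J' Y Y' a) (angularSpeed n W J J' Y Y' a t) t := by
  have hc : ContinuousOn (angularSpeed n W J J' Y Y' a) (Ioi 0) :=
    h.continuousOn_angularSpeed.comp (f := fun t => (a, t)) (by fun_prop) fun s hs => ⟨ha, hs⟩
  refine intervalIntegral.integral_hasDerivAt_right ?_ ?_ (hc.continuousAt (Ioi_mem_nhds ht))
  · refine (hc.mono fun s hs => ?_).intervalIntegrable
    exact (lt_min ha ht).trans_le hs.1
  · exact hc.stronglyMeasurableAtFilter isOpen_Ioi t ht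

/-- Scaling the interval of integration to `[r, R]` turns the angle into an integral with a
parameter. -/
lemma continuousOn_prueferAngle (h : IsFundamentalPair n W J J' Y Y') {r R : ℝ}
    (hr : 0 < r) (hrR : r < R) :
    ContinuousOn (fun x => prueferAngle n W J J' Y Y' (r * x) (R * x)) (Ioi 0) := by
  intro x₀ hx₀
  have hx₀' : 0 < x₀ / 2 := half_pos hx₀
  refine ContinuousAt.continuousWithinAt ?_
  -- The maxima keep both arguments positive without changing them for `x` near `x₀`, `s ∈ [r, R]`.
  have hc : Continuous (fun x => x * ∫ s in r..R, angularSpeed n W J J' Y Y'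
      (r * max x (x₀ / 2)) (max x (x₀ / 2) * max s r)) := by
    refine continuous_id.mul
      (intervalIntegral.continuous_parametric_intervalIntegral_of_continuous' ?_ r R)
    refine h.continuousOn_angularSpeed.comp_continuous
      (f := fun p : ℝ × ℝ => (r * max p.1 (x₀ / 2), max p.1 (x₀ / 2) * max p.2 r))
      (by fun_prop) fun p => ⟨?_, ?_⟩
    · exact mul_pos hr (lt_max_of_lt_right hx₀')
    · exact mul_pos (lt_max_of_lt_right hx₀') (lt_max_of_lt_right hr)
  refine hc.continuousAt.congr ?_
  filter_upwards [Ioi_mem_nhds (half_lt_self hx₀)] with x hx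
  rw [max_eq_left (le_of_lt hx), prueferAngle, mul_comm r x, mul_comm R x,
    ← intervalIntegral.mul_integral_comp_mul_left]
  congr 1
  refine intervalIntegral.integral_congr fun s hs => ?_
  rw [uIcc_of_le hrR.le] at hs
  simp only [max_eq_left hs.1]

/-- `prueferAngle` is the polar angle of the curve `(u / (2 t) + u', u)`, `u = kernel W J Y a`. -/
lemma polar (h : IsFundamentalPair n W J J' Y Y') {a t : ℝ} (ha : 0 < a) (ht : 0 < t) :
    ∃ ρ > 0, kernel W J Y a t = ρ * sin (prueferAngle n W J J' Y Y' a t) ∧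
      kernel W J Y a t / (2 * t) + kernelDeriv W J J' Y Y' a t =
        ρ * cos (prueferAngle n W J J' Y Y' a t) := by
  have hs := h.isBesselSol_kernel a
  refine ⟨_, sqrt_pos.2 (h.normSq_pos ha ht), ?_⟩
  set p := kernel W J Y a
  set p' := kernelDeriv W J J' Y Y' a
  refine polar_of_hasDerivAt (p := p) (q := fun t => p t / (2 * t) + p' t) (p' := p')
    (q' := fun t => -(p t / (2 * t) + p' t) / (2 * t) - (1 - (n ^ 2 - 1 / 4) / t ^ 2) * p t)
    ha hs.hasDerivAt ?_ (fun t ht => h.normSq_pos ha ht) ?_ (kernel_self a) ?_ ?_ ht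
  · intro t ht
    refine (((hs.hasDerivAt t ht).div ((hasDerivAt_id t).const_mul 2)
      (by simpa using ht.ne')).add (hs.hasDerivAt_deriv t ht)).congr_deriv ?_
    simp only [id]
    field_simp
    ring
  · intro t ht
    refine (h.hasDerivAt_prueferAngle ha ht).congr_deriv ?_
    simp only [angularSpeed]
    congr 1
    change (p t / (2 * t) + p' t) ^ 2 + _ * p t ^ 2 = _
    field_simp
    ring
  · change 0 < kernel W J Y a a / (2 * a) + kernelDeriv W J J' Y Y' a a
    rw [kernel_self, h.kernelDeriv_self ha]
    simpa using ha
  · simp [prueferAngle]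

/-- The Prüfer equation. -/
lemma hasDerivAt_prueferAngle' (h : IsFundamentalPair n W J J' Y Y') {a t : ℝ}
    (ha : 0 < a) (ht : 0 < t) :
    HasDerivAt (prueferAngle n W J J' Y Y' a)
      (1 - (n ^ 2 - 1 / 4) / t ^ 2 * sin (prueferAngle n W J J' Y Y' a t) ^ 2) t := by
  refine (h.hasDerivAt_prueferAngle ha ht).congr_deriv ?_
  obtain ⟨ρ, hρ, h1, h2⟩ := h.polar ha ht
  rw [angularSpeed, h2, h1]
  have : (ρ * sin (prueferAngle n W J J' Y Y' a t)) ^ 2 +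
      (ρ * cos (prueferAngle n W J J' Y Y' a t)) ^ 2 = ρ ^ 2 := by
    linear_combination ρ ^ 2 * sin_sq_add_cos_sq (prueferAngle n W J J' Y Y' a t)
  rw [this, div_eq_iff (by positivity)]
  linear_combination ρ ^ 2 * sin_sq_add_cos_sq (prueferAngle n W J J' Y Y' a t)

lemma kernel_eq_zero_iff (h : IsFundamentalPair n W J J' Y Y') {a t : ℝ}
    (ha : 0 < a) (ht : 0 < t) :
    kernel W J Y a t = 0 ↔ ∃ k : ℤ, prueferAngle n W J J' Y Y' a t = k * π := by
  obtain ⟨ρ, hρ, h1, -⟩ := h.polar ha ht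
  rw [h1, mul_eq_zero, or_iff_right hρ.ne', sin_eq_zero_iff]
  exact exists_congr fun k => eq_comm

/-- The angle starts at `0` and, by the Prüfer equation, has slope `1` whenever it is `0`. -/
lemma prueferAngle_pos (h : IsFundamentalPair n W J J' Y Y') {a b : ℝ}
    (ha : 0 < a) (hab : a < b) : 0 < prueferAngle n W J J' Y Y' a b := by
  refine lt_of_upcrossing (fun t ht =>
    (h.hasDerivAt_prueferAngle ha ht).continuousAt.continuousWithinAt) ?_ ha hab ?_
  · intro t ht h0
    have hd := h.hasDerivAt_prueferAngle' ha ht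
    rw [h0, sin_zero] at hd
    have hpos : 0 < deriv (prueferAngle n W J J' Y Y' a) t := by rw [hd.deriv]; norm_num
    filter_upwards [eventually_nhdsWithin_sign_eq_of_deriv_pos hpos h0] with s hs
    constructor
    · intro hlt
      rwa [sign_neg (sub_neg.2 hlt), sign_eq_neg_one_iff] at hs
    · intro hlt
      rwa [sign_pos (sub_pos.2 hlt), sign_eq_one_iff] at hs
  · simp [prueferAngle]

/-- As long as `Y` does not vanish, the kernel has no second zero after `a`, so the angle stays
below `π`. -/
lemma prueferAngle_lt_pi (h : IsFundamentalPair n W J J' Y Y') {a b : ℝ}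
    (ha : 0 < a) (hab : a < b) (hY : ∀ t ∈ Icc a b, Y t ≠ 0) :
    prueferAngle n W J J' Y Y' a b < π := by
  by_contra! hle
  have hc : ContinuousOn (prueferAngle n W J J' Y Y' a) (Icc a b) := fun t ht =>
    (h.hasDerivAt_prueferAngle ha (ha.trans_le ht.1)).continuousAt.continuousWithinAt
  obtain ⟨t, ht, hte⟩ := intermediate_value_Icc hab.le hc
    (show π ∈ Icc _ _ from ⟨by simp [prueferAngle, pi_pos.le], hle⟩)
  have ht0 : 0 < t := ha.trans_le ht.1
  have hat : a < t := by
    rcases ht.1.lt_or_eq with h' | h'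
    · exact h'
    · rw [← h'] at hte
      simp [prueferAngle] at hte
      exact absurd hte pi_pos.ne
  have hk : kernel W J Y a t = 0 := (h.kernel_eq_zero_iff ha ht0).2 ⟨1, by simpa using hte⟩
  have hq : J t / Y t = J a / Y a := by
    simp only [kernel, div_eq_zero_iff, h.ne_zero, or_false] at hk
    rw [div_eq_div_iff (hY t ht) (hY a (left_mem_Icc.2 hab.le))]
    linarith
  -- Between two equal values of `J / Y`, Rolle's theorem gives a zero of the Wronskian.
  obtain ⟨c, hc, hc0⟩ := exists_hasDerivAt_eq_zero (f := fun s => J s / Y s)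
    (f' := fun s => (J' s * Y s - J s * Y' s) / Y s ^ 2) hat
    (fun s hs => ((h.left.hasDerivAt s (ha.trans_le hs.1)).continuousAt.div
      (h.right.hasDerivAt s (ha.trans_le hs.1)).continuousAt
      (hY s ⟨hs.1, hs.2.trans ht.2⟩)).continuousWithinAt) hq.symm
    (fun s hs => (h.left.hasDerivAt s (ha.trans hs.1)).div (h.right.hasDerivAt s (ha.trans hs.1))
      (hY s ⟨hs.1.le, hs.2.le.trans ht.2⟩))
  rw [div_eq_zero_iff, or_iff_left (pow_ne_zero 2 (hY c ⟨hc.1.le, hc.2.le.trans ht.2⟩))] at hc0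
  apply h.ne_zero
  rw [← h.wronskian c (ha.trans hc.1)]
  linear_combination -c * hc0

/-- When both end points move in proportion, the angle passes through multiples of `π` only
upwards. -/
lemma prueferAngle_upcrossing (h : IsFundamentalPair n W J J' Y Y') {r R : ℝ}
    (hr : 0 < r) (hrR : r < R) {x₀ : ℝ} (hx₀ : 0 < x₀) {k : ℤ}
    (hk : prueferAngle n W J J' Y Y' (r * x₀) (R * x₀) = k * π) :
    ∀ᶠ x in 𝓝 x₀, (x < x₀ → prueferAngle n W J J' Y Y' (r * x) (R * x) < k * π) ∧
      (x₀ < x → k * π < prueferAngle n W J J' Y Y' (r * x) (R * x)) := by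
  have hR : 0 < R := hr.trans hrR
  set a := r * x₀ with ha'
  set b := R * x₀ with hb'
  have ha : 0 < a := mul_pos hr hx₀
  have hb : 0 < b := mul_pos hR hx₀
  have hab : a < b := mul_lt_mul_of_pos_right hrR hx₀
  have hz : kernel W J Y a b = 0 := (h.kernel_eq_zero_iff ha hb).2 ⟨k, hk⟩
  set β := kernelDeriv W J J' Y Y' a b with hβ
  set α := (J' a * Y b - J b * Y' a) / W with hα
  have henergy : 1 < b ^ 2 * β ^ 2 := by
    have hda := h.kernelDeriv_self ha
    have := (h.isBesselSol_kernel a).energy_lt ha hab (kernel_self a) hz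
      (by rw [hda]; positivity)
    rw [hda] at this
    field_simp at this
    simpa using this
  -- At a zero `(J, Y)` at `b` is a multiple of `(J, Y)` at `a`, so that `α` and `β` are tied by the
  -- Wronskian.
  have hαβ : α * β * (a * b) = -1 := by
    have hW := h.ne_zero
    have wa := h.wronskian a ha
    have wb := h.wronskian b hb
    simp only [kernel, div_eq_zero_iff, hW, or_false] at hz
    simp only [hα, hβ, kernelDeriv]
    field_simp
    linear_combination (-1) * W * wb - b * (J b * Y' b - J' b * Y b) * wa +
      a * b * (J' a * Y' b - J' b * Y' a) * hz
  have hder : HasDerivAt (fun x => kernel W J Y (r * x) (R * x)) (r * α + R * β) x₀ := by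
    have e1 : HasDerivAt (fun x => r * x) r x₀ := by
      simpa using (hasDerivAt_id x₀).const_mul r
    have e2 : HasDerivAt (fun x => R * x) R x₀ := by
      simpa using (hasDerivAt_id x₀).const_mul R
    refine (((((h.left.hasDerivAt a ha).comp x₀ e1).mul ((h.right.hasDerivAt b hb).comp x₀ e2)).sub
      (((h.left.hasDerivAt b hb).comp x₀ e2).mul
        ((h.right.hasDerivAt a ha).comp x₀ e1))).div_const W).congr_deriv ?_
    simp only [hα, hβ, kernelDeriv, Function.comp]
    change (J' a * r * Y b + J a * (Y' b * R) - (J' b * R * Y a + J b * (Y' a * r))) / W = _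
    ring
  have hprod : 0 < (r * α + R * β) * β := by
    have : (r * α + R * β) * β * (x₀ * b) = b ^ 2 * β ^ 2 - 1 := by
      rw [← sub_eq_zero]
      linear_combination hαβ + (-(α * β * b)) * ha' - b * β ^ 2 * hb'
    exact pos_of_mul_pos_left (this ▸ sub_pos.2 henergy) (by positivity)
  obtain ⟨ρ, hρ, -, h2⟩ := h.polar ha hb
  rw [hz, hk, zero_div, zero_add] at h2
  -- The factor `cos (k π) = ±1` normalises the sign, so that the function below increases at `x₀`.
  have hcos : 0 < deriv (fun x => cos (k * π) * kernel W J Y (r * x) (R * x)) x₀ := by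
    rw [(hder.const_mul _).deriv]
    have : (cos (k * π) * (r * α + R * β)) * ρ = (r * α + R * β) * β := by
      rw [hβ, h2]; ring
    exact pos_of_mul_pos_left (this ▸ hprod) hρ.le
  have hcont : ContinuousAt (fun x => prueferAngle n W J J' Y Y' (r * x) (R * x)) x₀ :=
    (h.continuousOn_prueferAngle hr hrR).continuousAt (Ioi_mem_nhds hx₀)
  have hnear : ∀ᶠ x in 𝓝 x₀, prueferAngle n W J J' Y Y' (r * x) (R * x) ∈
      Ioo (k * π - π) (k * π + π) := by
    refine hcont.eventually (Ioo_mem_nhds ?_ ?_)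
    · change _ < prueferAngle n W J J' Y Y' a b
      rw [hk]; linarith [pi_pos]
    · change prueferAngle n W J J' Y Y' a b < _
      rw [hk]; linarith [pi_pos]
  filter_upwards [eventually_nhdsWithin_sign_eq_of_deriv_pos hcos
    (by simp only [← ha', ← hb', hz, mul_zero]), hnear, Ioi_mem_nhds hx₀] with x hx hxn hx0
  obtain ⟨ρ', hρ', h1', -⟩ := h.polar (mul_pos hr hx0) (mul_pos hR hx0)
  set φ := prueferAngle n W J J' Y Y' (r * x) (R * x)
  have hsin : cos (k * π) * kernel W J Y (r * x) (R * x) = ρ' * sin (φ - k * π) := by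
    rw [h1', sin_sub, sin_int_mul_pi]; ring
  rw [hsin] at hx
  constructor
  · intro hlt
    rw [sign_neg (sub_neg.2 hlt), sign_eq_neg_one_iff] at hx
    by_contra! hge
    have := sin_nonneg_of_nonneg_of_le_pi (x := φ - k * π) (by linarith) (by linarith [hxn.2])
    nlinarith
  · intro hlt
    rw [sign_pos (sub_pos.2 hlt), sign_eq_one_iff] at hx
    by_contra! hge
    have := sin_nonpos_of_nonpos_of_neg_pi_le (x := φ - k * π) (by linarith) (by linarith [hxn.1])
    nlinarith

lemma abs_prueferAngle_sub_le (h : IsFundamentalPair n W J J' Y Y') {r R : ℝ}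
    (hr : 0 < r) (hrR : r < R) : ∃ D : ℝ, 0 ≤ D ∧ ∀ x, 1 ≤ x →
      |prueferAngle n W J J' Y Y' (r * x) (R * x) - (R - r) * x -
        (n ^ 2 - 1 / 4) / 2 * (1 / R - 1 / r) / x| ≤ D / x ^ 2 := by
  have hR : 0 < R := hr.trans hrR
  set μ := n ^ 2 - 1 / 4 with hμ
  have hRr : 0 ≤ R - r := by linarith
  refine ⟨|μ| / 2 * (|μ| / r ^ 4 + 1 / r ^ 3) * (R - r) + |μ| / 4 / R ^ 2, by positivity, ?_⟩
  intro x hx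
  have hx0 : 0 < x := by linarith
  have hest := pruefer_angle_estimate (μ := μ) (mul_pos hr hx0)
    (mul_le_mul_of_nonneg_right hrR.le hx0.le)
    (fun t ht => h.hasDerivAt_prueferAngle' (mul_pos hr hx0) ht) (by simp [prueferAngle])
  have e1 : prueferAngle n W J J' Y Y' (r * x) (R * x) - (R * x - r * x) -
      μ / 2 * (1 / (R * x) - 1 / (r * x)) = prueferAngle n W J J' Y Y' (r * x) (R * x) -
        (R - r) * x - μ / 2 * (1 / R - 1 / r) / x := by
    field_simp
  rw [e1] at hest
  refine hest.trans ?_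
  have e2 : |μ| / 2 * (|μ| / (r * x) ^ 4 + 1 / (r * x) ^ 3) * (R * x - r * x) ≤
      |μ| / 2 * (|μ| / r ^ 4 + 1 / r ^ 3) * (R - r) / x ^ 2 := by
    have e3 : |μ| / 2 * (|μ| / (r * x) ^ 4 + 1 / (r * x) ^ 3) * (R * x - r * x) =
      |μ| / 2 * (|μ| / r ^ 4 / x + 1 / r ^ 3) * (R - r) / x ^ 2 := by
      field_simp
    rw [e3]
    have : |μ| / r ^ 4 / x ≤ |μ| / r ^ 4 := div_le_self (by positivity) hx
    gcongr
  have e4 : |μ| / 4 / (R * x) ^ 2 = |μ| / 4 / R ^ 2 / x ^ 2 := by field_simp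
  rw [e4, add_div]
  exact add_le_add e2 le_rfl

end IsFundamentalPair

/-! ### `J_n` and `Y_n` as solutions of Bessel's equation -/

/-- The integrals over `[0, π]` which occur in `J_n`, `Y_n` and their derivatives. The phase `β` is `0`
for the cosine and `-π / 2` for the sine; differentiation in `x` raises `m` by one and `β` by
`π / 2`. -/
noncomputable def angularIntegral (n m : ℕ) (β x : ℝ) : ℝ :=
  ∫ θ in (0 : ℝ)..π, sin θ ^ m * cos (x * sin θ - n * θ + β)

lemma hasDerivAt_angularIntegral (n m : ℕ) (β x : ℝ) :
    HasDerivAt (angularIntegral n m β) (angularIntegral n (m + 1) (β + π / 2) x) x := by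
  have hint : ∀ (m : ℕ) (β x : ℝ),
      Continuous fun θ : ℝ => sin θ ^ m * cos (x * sin θ - n * θ + β) := by fun_prop
  refine (intervalIntegral.hasDerivAt_integral_of_dominated_loc_of_deriv_le
    (F := fun x θ => sin θ ^ m * cos (x * sin θ - n * θ + β))
    (F' := fun x θ => sin θ ^ (m + 1) * cos (x * sin θ - n * θ + (β + π / 2)))
    (bound := fun _ => 1) univ_mem
    (Eventually.of_forall fun y => (hint m β y).aestronglyMeasurable)
    ((hint m β x).intervalIntegrable _ _) (hint _ _ x).aestronglyMeasurable
    (Eventually.of_forall fun θ _ y _ => ?_) intervalIntegrable_const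
    (Eventually.of_forall fun θ _ y _ => ?_)).2
  · rw [norm_mul, norm_pow, norm_eq_abs, norm_eq_abs]
    exact mul_le_one₀ (pow_le_one₀ (abs_nonneg _) (abs_sin_le_one _)) (abs_nonneg _)
      (abs_cos_le_one _)
  · have h : HasDerivAt (fun y => y * sin θ - n * θ + β) (sin θ) y := by
      simpa using (((hasDerivAt_id y).mul_const (sin θ)).sub_const (n * θ)).add_const β
    refine (h.cos.const_mul (sin θ ^ m)).congr_deriv ?_
    rw [← add_assoc, cos_add_pi_div_two]
    ring

/-- Bessel's operator applied to the angular integral leaves boundary terms only: the integrand becomes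
the derivative of `(x cos θ + n) sin (x sin θ - n θ + β)` in `θ`. -/
lemma angularIntegral_bessel_operator (n : ℕ) (β x : ℝ) :
    x ^ 2 * angularIntegral n 2 (β + π / 2 + π / 2) x + x * angularIntegral n 1 (β + π / 2) x +
      (x ^ 2 - n ^ 2) * angularIntegral n 0 β x =
      (n - x) * sin (-(n * π) + β) - (x + n) * sin β := by
  have hint : ∀ (m : ℕ) (β : ℝ),
      IntervalIntegrable (fun θ : ℝ => sin θ ^ m * cos (x * sin θ - n * θ + β)) volume 0 π :=
    fun m β => Continuous.intervalIntegrable (by fun_prop) _ _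
  simp only [angularIntegral]
  rw [← intervalIntegral.integral_const_mul, ← intervalIntegral.integral_const_mul,
    ← intervalIntegral.integral_const_mul, ← intervalIntegral.integral_add
      ((hint _ _).const_mul _) ((hint _ _).const_mul _), ← intervalIntegral.integral_add
      (((hint _ _).const_mul _).add ((hint _ _).const_mul _)) ((hint _ _).const_mul _)]
  rw [intervalIntegral.integral_eq_sub_of_hasDerivAt
    (f := fun θ => (x * cos θ + n) * sin (x * sin θ - n * θ + β))]
  · simp only [sin_pi, cos_pi, sin_zero, cos_zero]
    ring_nf
  · intro θ _
    have h : HasDerivAt (fun θ => x * sin θ - n * θ + β) (x * cos θ - n) θ := by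
      simpa using (((hasDerivAt_sin θ).const_mul x).sub
        ((hasDerivAt_id θ).const_mul (n : ℝ))).add_const β
    refine ((((hasDerivAt_cos θ).const_mul x).add_const (n : ℝ)).mul h.sin).congr_deriv ?_
    rw [← add_assoc, ← add_assoc, cos_add_pi_div_two, cos_add_pi_div_two, sin_add_pi_div_two]
    linear_combination x ^ 2 * cos (x * sin θ - n * θ + β) * sin_sq_add_cos_sq θ
  · exact (((hint _ _).const_mul _).add ((hint _ _).const_mul _)).add ((hint _ _).const_mul _)

/-- `p` is continuous and grows at most exponentially at `+∞`, hence is integrable on `(0, ∞)` against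
`exp (-x sinh t)` for `x > 0`. -/
def HasExpGrowth (p : ℝ → ℝ) : Prop :=
  Continuous p ∧ ∃ c : ℝ, p =O[atTop] fun t => exp (c * t)

namespace HasExpGrowth

variable {p q : ℝ → ℝ}

lemma add (hp : HasExpGrowth p) (hq : HasExpGrowth q) : HasExpGrowth fun t => p t + q t := by
  obtain ⟨hpc, c, hc⟩ := hp
  obtain ⟨hqc, d, hd⟩ := hq
  have hle : ∀ a b : ℝ, a ≤ b → (fun t => exp (a * t)) =O[atTop] fun t => exp (b * t) := by
    intro a b hab
    refine IsBigO.of_bound 1 ?_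
    filter_upwards [eventually_ge_atTop 0] with t ht
    rw [norm_eq_abs, abs_exp, norm_eq_abs, abs_exp, one_mul]
    gcongr
  exact ⟨hpc.add hqc, max c d, (hc.trans (hle _ _ (le_max_left _ _))).add
    (hd.trans (hle _ _ (le_max_right _ _)))⟩

lemma mul (hp : HasExpGrowth p) (hq : HasExpGrowth q) : HasExpGrowth fun t => p t * q t := by
  obtain ⟨hpc, c, hc⟩ := hp
  obtain ⟨hqc, d, hd⟩ := hq
  refine ⟨hpc.mul hqc, c + d, (hc.mul hd).congr_right fun t => ?_⟩
  rw [← exp_add, add_mul]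

lemma const (c : ℝ) : HasExpGrowth fun _ => c :=
  ⟨continuous_const, 0, by simpa using isBigO_const_const c (one_ne_zero (α := ℝ)) atTop⟩

lemma exp_mul (c : ℝ) : HasExpGrowth fun t => exp (c * t) :=
  ⟨by fun_prop, c, isBigO_refl _ _⟩

lemma sinh : HasExpGrowth Real.sinh := by
  have h := ((exp_mul 1).mul (const (1 / 2))).add ((exp_mul (-1)).mul (const (-1 / 2)))
  refine (congrArg HasExpGrowth (funext fun t => ?_)).mp h
  rw [sinh_eq, one_mul, neg_one_mul]; ring

lemma cosh : HasExpGrowth Real.cosh := by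
  have h := ((exp_mul 1).mul (const (1 / 2))).add ((exp_mul (-1)).mul (const (1 / 2)))
  refine (congrArg HasExpGrowth (funext fun t => ?_)).mp h
  rw [cosh_eq, one_mul, neg_one_mul]; ring

lemma isBigO_exp_neg (hp : HasExpGrowth p) {x : ℝ} (hx : 0 < x) :
    (fun t => p t * exp (-(x * Real.sinh t))) =O[atTop] fun t => exp (-1 * t) := by
  obtain ⟨-, c, hc⟩ := hp
  refine (hc.mul (isBigO_refl (fun t => exp (-(x * Real.sinh t))) _)).trans
    (IsBigO.of_bound 1 ?_)
  filter_upwards [eventually_ge_atTop 0, eventually_ge_atTop (4 * (c + 1) / x)] with t ht ht'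
  rw [← exp_add, norm_eq_abs, abs_exp, norm_eq_abs, abs_exp, one_mul]
  refine exp_le_exp.2 ?_
  have h1 : t ^ 2 / 4 ≤ Real.sinh t := by
    have h2 := quadratic_le_exp_of_nonneg ht
    have h3 : exp (-t) ≤ 1 := exp_le_one_iff.2 (by linarith)
    rw [sinh_eq]
    linarith
  rw [div_le_iff₀ hx] at ht'
  nlinarith

lemma integrableOn (hp : HasExpGrowth p) {x : ℝ} (hx : 0 < x) :
    IntegrableOn (fun t => p t * exp (-(x * Real.sinh t))) (Ioi 0) := by
  have := hp.1
  exact integrable_of_isBigO_exp_neg one_pos (Continuous.continuousOn (by fun_prop))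
    (hp.isBigO_exp_neg hx)

lemma tendsto_zero (hp : HasExpGrowth p) {x : ℝ} (hx : 0 < x) :
    Tendsto (fun t => p t * exp (-(x * Real.sinh t))) atTop (𝓝 0) := by
  refine (hp.isBigO_exp_neg hx).trans_tendsto ?_
  simpa using tendsto_exp_neg_atTop_nhds_zero

end HasExpGrowth

/-- The integral `∫₀^∞ p(t) exp (-x sinh t) dt`. -/
noncomputable def sinhLaplace (p : ℝ → ℝ) (x : ℝ) : ℝ :=
  ∫ t in Ioi (0 : ℝ), p t * exp (-(x * sinh t))

lemma hasDerivAt_sinhLaplace {p : ℝ → ℝ} (hp : HasExpGrowth p) {x : ℝ} (hx : 0 < x) :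
    HasDerivAt (sinhLaplace p) (-sinhLaplace (fun t => p t * sinh t) x) x := by
  have hps := hp.mul HasExpGrowth.sinh
  have hpc := hp.1
  rw [sinhLaplace, ← integral_neg]
  refine (hasDerivAt_integral_of_dominated_loc_of_deriv_le
    (F := fun x t => p t * exp (-(x * sinh t)))
    (F' := fun x t => -(p t * sinh t * exp (-(x * sinh t))))
    (bound := fun t => ‖p t * sinh t * exp (-(x / 2 * sinh t))‖)
    (Ioi_mem_nhds (half_lt_self hx)) (Eventually.of_forall fun y => ?_) (hp.integrableOn hx)
    ?_ ?_ (hps.integrableOn (half_pos hx)).norm (Eventually.of_forall fun t y _ => ?_)).2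
  · exact Continuous.aestronglyMeasurable (by fun_prop)
  · exact Continuous.aestronglyMeasurable (by fun_prop)
  · refine (ae_restrict_iff' measurableSet_Ioi).2 (Eventually.of_forall fun t ht y hy => ?_)
    rw [norm_neg, norm_mul, norm_mul _ (exp _), norm_eq_abs (exp _), norm_eq_abs (exp _),
      abs_exp, abs_exp]
    have : 0 < sinh t := sinh_pos_iff.2 ht
    have : x / 2 < y := hy
    gcongr
  · have h : HasDerivAt (fun y => -(y * sinh t)) (-sinh t) y :=
      ((hasDerivAt_id y).mul_const (sinh t)).neg.congr_deriv (by simp)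
    refine (h.exp.const_mul (p t)).congr_deriv ?_
    ring

/-- The weight `exp (n t) + (-1)ⁿ exp (-n t)` of the second integral in `Y_n`. -/
noncomputable def neumannWeight (n : ℕ) (t : ℝ) : ℝ :=
  exp (n * t) + exp (-(n * t)) * cos (n * π)

lemma hasExpGrowth_neumannWeight (n : ℕ) : HasExpGrowth (neumannWeight n) := by
  have h := (HasExpGrowth.exp_mul n).add
    ((HasExpGrowth.exp_mul (-n)).mul (HasExpGrowth.const (cos (n * π))))
  refine (congrArg HasExpGrowth (funext fun t => ?_)).mp h
  rw [neumannWeight, neg_mul]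

lemma neumannWeight_nonneg (n : ℕ) {t : ℝ} (ht : 0 ≤ t) : 0 ≤ neumannWeight n t := by
  have h1 : exp (-(n * t)) ≤ exp (n * t) :=
    exp_le_exp.2 (by have := mul_nonneg (Nat.cast_nonneg (α := ℝ) n) ht; linarith)
  have h2 := neg_one_le_cos (n * π)
  have h3 := exp_pos (-(n * t))
  rw [neumannWeight]
  nlinarith

lemma one_le_neumannWeight (n : ℕ) {t : ℝ} (ht : 1 ≤ t) : 1 ≤ neumannWeight n t := by
  rw [neumannWeight]
  rcases Nat.eq_zero_or_pos n with rfl | hn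
  · simp
  · have hn' : (1 : ℝ) ≤ n := by exact_mod_cast hn
    have h0 : 1 ≤ n * t := one_le_mul_of_one_le_of_one_le hn' ht
    have h1 : n * t + 1 ≤ exp (n * t) := add_one_le_exp _
    have h2 := neg_one_le_cos (n * π)
    have h3 := exp_pos (-(n * t))
    have h4 : exp (-(n * t)) ≤ 1 := exp_le_one_iff.2 (by linarith)
    nlinarith

/-- Bessel's operator applied to the second integral in `Y_n` leaves boundary terms at `t = 0` only; they
are those of the first integral. -/
lemma sinhLaplace_bessel_operator (n : ℕ) {x : ℝ} (hx : 0 < x) :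
    x ^ 2 * sinhLaplace (fun t => neumannWeight n t * sinh t * sinh t) x -
      x * sinhLaplace (fun t => neumannWeight n t * sinh t) x +
      (x ^ 2 - n ^ 2) * sinhLaplace (neumannWeight n) x =
      (x + n) + cos (n * π) * (x - n) := by
  have h0 := hasExpGrowth_neumannWeight n
  have h1 := h0.mul HasExpGrowth.sinh
  have h2 := h1.mul HasExpGrowth.sinh
  have i0 := (h0.integrableOn hx).const_mul (x ^ 2 - (n : ℝ) ^ 2)
  have i1 := (h1.integrableOn hx).const_mul x
  have i2 := (h2.integrableOn hx).const_mul (x ^ 2)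
  have i21 := i2.sub i1
  have i210 := i21.add i0
  simp only [Pi.sub_def, Pi.add_def] at i21 i210
  have hw : HasExpGrowth fun t => -(x * cosh t + n) * exp (n * t) +
      -(x * cosh t - n) * (exp (-n * t) * cos (n * π)) := by
    have hc := (HasExpGrowth.const x).mul HasExpGrowth.cosh
    have e := (((HasExpGrowth.const (-1)).mul (hc.add (HasExpGrowth.const n))).mul
      (HasExpGrowth.exp_mul n)).add
      (((HasExpGrowth.const (-1)).mul (hc.add (HasExpGrowth.const (-n)))).mul
        ((HasExpGrowth.exp_mul (-n)).mul (HasExpGrowth.const (cos (n * π)))))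
    refine (congrArg HasExpGrowth (funext fun t => ?_)).mp e
    ring
  simp only [sinhLaplace]
  rw [← integral_const_mul, ← integral_const_mul, ← integral_const_mul, ← integral_sub i2 i1,
    ← integral_add i21 i0]
  rw [integral_Ioi_of_hasDerivAt_of_tendsto' (f := fun t => (-(x * cosh t + n) * exp (n * t) +
      -(x * cosh t - n) * (exp (-n * t) * cos (n * π))) * exp (-(x * sinh t))) (m := 0)
      (fun t _ => ?_) i210 (hw.tendsto_zero hx)]
  · simp
    ring
  · have e1 : HasDerivAt (fun t => exp (n * t)) (exp (n * t) * n) t := by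
      simpa using ((hasDerivAt_id t).const_mul (n : ℝ)).exp
    have e2 : HasDerivAt (fun t => exp (-n * t)) (exp (-n * t) * -n) t := by
      simpa using ((hasDerivAt_id t).const_mul (-n : ℝ)).exp
    have e3 : HasDerivAt (fun t => exp (-(x * sinh t)))
        (exp (-(x * sinh t)) * -(x * cosh t)) t := ((hasDerivAt_sinh t).const_mul x).neg.exp
    have hc := (hasDerivAt_cosh t).const_mul x
    refine ((((hc.add_const (n : ℝ)).neg.mul e1).add
      ((hc.sub_const (n : ℝ)).neg.mul (e2.mul_const (cos (n * π))))).mul e3).congr_deriv ?_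
    simp only [neumannWeight, Pi.add_apply, Pi.mul_apply, Pi.neg_apply, neg_mul]
    linear_combination (x ^ 2 * exp (-(x * sinh t)) *
      (exp (n * t) + exp (-(n * t)) * cos (n * π))) * cosh_sq t

/-- The derivative of `J_n`, as an integral. -/
noncomputable def besselJDeriv (n : ℕ) (x : ℝ) : ℝ := 1 / π * angularIntegral n 1 (π / 2) x

/-- The derivative of `Y_n` on `(0, ∞)`, as a sum of two integrals. -/
noncomputable def besselYDeriv (n : ℕ) (x : ℝ) : ℝ :=
  1 / π * angularIntegral n 1 0 x + 1 / π * sinhLaplace (fun t => neumannWeight n t * sinh t) x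

lemma besselJ_eq (n : ℕ) : besselJ n = fun x => 1 / π * angularIntegral n 0 0 x := by
  funext x
  simp [besselJ, angularIntegral]

lemma besselY_eq (n : ℕ) : besselY n = fun x =>
    1 / π * angularIntegral n 0 (-(π / 2)) x - 1 / π * sinhLaplace (neumannWeight n) x := by
  funext x
  simp only [besselY, angularIntegral, sinhLaplace, neumannWeight, pow_zero, one_mul,
    ← sub_eq_add_neg, cos_sub_pi_div_two]

lemma hasDerivAt_besselJ (n : ℕ) (x : ℝ) : HasDerivAt (besselJ n) (besselJDeriv n x) x := by
  rw [besselJ_eq]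
  refine ((hasDerivAt_angularIntegral n 0 0 x).const_mul (1 / π)).congr_deriv ?_
  rw [besselJDeriv, zero_add, zero_add]

lemma isBesselSol_besselJ (n : ℕ) : IsBesselSol n (besselJ n) (besselJDeriv n) := by
  refine ⟨fun t _ => hasDerivAt_besselJ n t, fun t ht => ?_⟩
  refine ((hasDerivAt_angularIntegral n 1 (π / 2) t).const_mul (1 / π)).congr_deriv ?_
  have h := angularIntegral_bessel_operator n 0 t
  simp only [zero_add, add_zero, sin_zero, mul_zero, sin_neg, sin_nat_mul_pi, neg_zero,
    sub_zero] at h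
  rw [show π / 2 + π / 2 = π by ring] at h ⊢
  simp only [besselJDeriv, besselJ_eq]
  field_simp
  linear_combination h

lemma isBesselSol_besselY (n : ℕ) : IsBesselSol n (besselY n) (besselYDeriv n) := by
  have hw := hasExpGrowth_neumannWeight n
  refine ⟨fun t ht => ?_, fun t ht => ?_⟩
  · rw [besselY_eq]
    refine (((hasDerivAt_angularIntegral n 0 (-(π / 2)) t).const_mul (1 / π)).sub
      ((hasDerivAt_sinhLaplace hw ht).const_mul (1 / π))).congr_deriv ?_
    rw [besselYDeriv, zero_add, neg_add_cancel]
    ring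
  · refine (((hasDerivAt_angularIntegral n 1 0 t).const_mul (1 / π)).add
      ((hasDerivAt_sinhLaplace (hw.mul HasExpGrowth.sinh) ht).const_mul (1 / π))).congr_deriv ?_
    have h1 := angularIntegral_bessel_operator n (-(π / 2)) t
    have h2 := sinhLaplace_bessel_operator n ht
    rw [neg_add_cancel, zero_add, sin_neg, sin_pi_div_two, ← sub_eq_add_neg, sin_sub_pi_div_two,
      cos_neg] at h1
    simp only [mul_assoc] at h2
    simp only [besselYDeriv, besselY_eq, zero_add, mul_assoc]
    field_simp
    simp only [← pow_two] at h2
    linear_combination h1 - h2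

lemma abs_besselJ_le_one (n : ℕ) (x : ℝ) : |besselJ n x| ≤ 1 := by
  have h := intervalIntegral.norm_integral_le_of_norm_le_const (a := 0) (b := π) (C := 1)
    (f := fun θ => cos (x * sin θ - n * θ)) fun θ _ => abs_cos_le_one _
  rw [norm_eq_abs, sub_zero, abs_of_pos pi_pos, one_mul] at h
  rw [besselJ, abs_mul, abs_of_pos (by positivity), one_div, inv_mul_le_iff₀ pi_pos, mul_one]
  exact h

/-- `Y_n` tends to `-∞` at `0+`. -/
lemma exists_besselY_lt (n : ℕ) (M : ℝ) : ∃ ε > 0, ∀ x, 0 < x → x < ε → besselY n x < M := by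
  -- For `x sinh T ≤ 1` the integrand is at least `exp (-1)` on `[1, T]`, and `T` is at our disposal.
  set T : ℝ := max (exp 1 * (π * (2 - M)) + 1) 2 with hT
  have hT2 : 2 ≤ T := le_max_right _ _
  have hsT : 0 < sinh T := sinh_pos_iff.2 (by linarith)
  refine ⟨1 / sinh T, by positivity, fun x hx hxT => ?_⟩
  rw [lt_div_iff₀ hsT] at hxT
  have hint := (hasExpGrowth_neumannWeight n).integrableOn hx
  have hsub : Ioc 1 T ⊆ Ioi 0 := fun t ht => one_pos.trans ht.1
  have hlow : (T - 1) * exp (-1) ≤ sinhLaplace (neumannWeight n) x := by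
    calc (T - 1) * exp (-1) = ∫ _ in Ioc 1 T, exp (-1) := by
          rw [setIntegral_const]; simp [max_eq_left (by linarith : (0 : ℝ) ≤ T - 1)]
      _ ≤ ∫ t in Ioc 1 T, neumannWeight n t * exp (-(x * sinh t)) := by
          refine setIntegral_mono_on (integrableOn_const (by simp)) (hint.mono_set hsub)
            measurableSet_Ioc fun t ht => ?_
          have h1 := one_le_neumannWeight n ht.1.le
          have h2 : exp (-1) ≤ exp (-(x * sinh t)) := by
            refine exp_le_exp.2 (neg_le_neg ?_)
            have := mul_le_mul_of_nonneg_left (sinh_le_sinh.2 ht.2) hx.le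
            linarith
          nlinarith [exp_pos (-1)]
      _ ≤ sinhLaplace (neumannWeight n) x := by
          refine setIntegral_mono_set hint ?_ (Eventually.of_forall hsub)
          refine (ae_restrict_iff' measurableSet_Ioi).2 (Eventually.of_forall fun t ht => ?_)
          exact mul_nonneg (neumannWeight_nonneg n (le_of_lt ht)) (exp_pos _).le
  have hang : angularIntegral n 0 (-(π / 2)) x ≤ π := by
    have h := intervalIntegral.norm_integral_le_of_norm_le_const (a := 0) (b := π) (C := 1)
      (f := fun θ => sin θ ^ 0 * cos (x * sin θ - n * θ + -(π / 2))) fun θ _ => by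
        rw [pow_zero, one_mul]
        exact abs_cos_le_one _
    rw [sub_zero, abs_of_pos pi_pos, one_mul] at h
    exact (le_abs_self _).trans h
  have hT1 : π * (2 - M) ≤ (T - 1) * exp (-1) := by
    have h : exp 1 * (π * (2 - M)) + 1 ≤ T := le_max_left _ _
    rw [exp_neg, ← div_eq_mul_inv, le_div_iff₀ (exp_pos 1)]
    linarith
  rw [besselY_eq]
  have : (1 / π * angularIntegral n 0 (-(π / 2)) x - 1 / π * sinhLaplace (neumannWeight n) x) =
      (angularIntegral n 0 (-(π / 2)) x - sinhLaplace (neumannWeight n) x) / π := by ring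
  change 1 / π * angularIntegral n 0 (-(π / 2)) x - 1 / π * sinhLaplace (neumannWeight n) x < M
  rw [this, div_lt_iff₀ pi_pos]
  linarith [pi_pos]

/-- The recurrence `J_n = J_{n+1}' + ((n + 1) / x) J_{n+1}`; the difference of the two sides is a multiple
of `∫₀^π (sin (x sin θ - (n + 1) θ))' dθ = 0`. -/
lemma besselJ_recurrence (n : ℕ) {x : ℝ} (hx : x ≠ 0) :
    besselJ n x = besselJDeriv (n + 1) x + (n + 1) / x * besselJ (n + 1) x := by
  have h0 : ∫ θ in (0 : ℝ)..π, (x * cos θ - (n + 1)) * cos (x * sin θ - (n + 1) * θ) = 0 := by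
    rw [intervalIntegral.integral_eq_sub_of_hasDerivAt
      (f := fun θ => sin (x * sin θ - (n + 1) * θ))]
    · have h := sin_nat_mul_pi (n + 1)
      push_cast at h
      simp [h]
    · intro θ _
      have h : HasDerivAt (fun θ => x * sin θ - (n + 1) * θ) (x * cos θ - (n + 1)) θ :=
        (((hasDerivAt_sin θ).const_mul x).sub
          ((hasDerivAt_id θ).const_mul ((n : ℝ) + 1))).congr_deriv (by simp)
      refine h.sin.congr_deriv (mul_comm _ _)
    · exact Continuous.intervalIntegrable (by fun_prop) _ _
  have hi : ∀ f : ℝ → ℝ, Continuous f → IntervalIntegrable f volume 0 π :=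
    fun f hf => hf.intervalIntegrable _ _
  have h1 : (∫ θ in (0 : ℝ)..π, cos (x * sin θ - n * θ)) =
      ∫ θ in (0 : ℝ)..π, (sin θ ^ 1 * cos (x * sin θ - (n + 1 : ℕ) * θ + π / 2) +
        (n + 1) / x * cos (x * sin θ - (n + 1 : ℕ) * θ)) +
        1 / x * ((x * cos θ - (n + 1)) * cos (x * sin θ - (n + 1) * θ)) := by
    refine intervalIntegral.integral_congr fun θ _ => ?_
    have e : x * sin θ - n * θ = (x * sin θ - (n + 1) * θ) + θ := by ring
    simp only [e, cos_add, cos_pi_div_two, sin_pi_div_two]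
    push_cast
    field_simp
    ring
  rw [besselJ, h1, intervalIntegral.integral_add (hi _ (by fun_prop)) (hi _ (by fun_prop)),
    intervalIntegral.integral_add (hi _ (by fun_prop)) (hi _ (by fun_prop)),
    intervalIntegral.integral_const_mul, intervalIntegral.integral_const_mul, h0, besselJDeriv,
    besselJ, angularIntegral]
  ring

/-- `J_n` does not vanish identically near `0`: by the recurrence this reduces to `J_0(0) = 1`. -/
lemma besselJ_not_eventually_zero (n : ℕ) : ¬ ∀ᶠ x in 𝓝[>] (0 : ℝ), besselJ n x = 0 := by
  induction n with
  | zero =>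
    intro h
    have h1 : besselJ 0 0 = 1 := by simp [besselJ]
    have h2 := ((hasDerivAt_besselJ 0 0).continuousAt.tendsto.mono_left
      (nhdsWithin_le_nhds (s := Ioi 0))).congr' h
    rw [h1] at h2
    exact zero_ne_one (tendsto_nhds_unique tendsto_const_nhds h2)
  | succ n ih =>
    intro h
    apply ih
    obtain ⟨ε, hε, h⟩ := mem_nhdsGT_iff_exists_Ioo_subset.1 h
    filter_upwards [Ioo_mem_nhdsGT hε] with x hx
    have h0 : besselJ (n + 1) =ᶠ[𝓝 x] fun _ => 0 := by
      filter_upwards [Ioo_mem_nhds hx.1 hx.2] with t ht using h ht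
    have hd := (hasDerivAt_besselJ (n + 1) x).unique
      ((hasDerivAt_const x (0 : ℝ)).congr_of_eventuallyEq h0)
    rw [besselJ_recurrence n hx.1.ne', hd, h0.eq_of_nhds]
    simp

lemma exists_isFundamentalPair (n : ℕ) : ∃ W : ℝ,
    IsFundamentalPair n W (besselJ n) (besselJDeriv n) (besselY n) (besselYDeriv n) := by
  have hJ := isBesselSol_besselJ n
  have hY := isBesselSol_besselY n
  have hc := fun t (ht : t > 0) => hJ.wronskian_const hY ht one_pos
  refine ⟨_, hJ, hY, hc, fun hW => besselJ_not_eventually_zero n ?_⟩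
  -- If the Wronskian vanished, `J / Y` would be constant near `0`; there `J` is bounded while
  -- `Y` is not, so the constant would be `0`.
  obtain ⟨ε, hε, hneg⟩ := exists_besselY_lt n 0
  have hq : ∀ x ∈ Ioo 0 ε, besselJ n x / besselY n x = besselJ n (ε / 2) / besselY n (ε / 2) := by
    have hd : ∀ x ∈ Ioo 0 ε, HasDerivAt (fun x => besselJ n x / besselY n x) 0 x := by
      intro x hx
      refine ((hJ.hasDerivAt x hx.1).div (hY.hasDerivAt x hx.1)
        (hneg x hx.1 hx.2).ne).congr_deriv ?_
      have h := (hc x hx.1).trans hW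
      rw [mul_eq_zero, or_iff_right hx.1.ne'] at h
      rw [div_eq_zero_iff]
      left
      linarith
    intro x hx
    exact isOpen_Ioo.is_const_of_deriv_eq_zero isPreconnected_Ioo
      (fun s hs => (hd s hs).differentiableAt.differentiableWithinAt)
      (fun s hs => (hd s hs).deriv) hx ⟨half_pos hε, half_lt_self hε⟩
  set c := besselJ n (ε / 2) / besselY n (ε / 2)
  have hc0 : c = 0 := by
    by_contra hc0
    obtain ⟨ε', hε', hlt⟩ := exists_besselY_lt n (-(1 / |c|))
    have hm : 0 < min ε ε' / 2 := half_pos (lt_min hε hε')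
    have hm1 : min ε ε' / 2 < ε := (half_lt_self (lt_min hε hε')).trans_le (min_le_left _ _)
    have hm2 : min ε ε' / 2 < ε' := (half_lt_self (lt_min hε hε')).trans_le (min_le_right _ _)
    have h1 := hq _ ⟨hm, hm1⟩
    have h2 := hlt _ hm hm2
    have h3 := hneg _ hm hm1
    rw [div_eq_iff h3.ne] at h1
    have h4 := abs_besselJ_le_one n (min ε ε' / 2)
    rw [h1, abs_mul, abs_of_neg h3] at h4
    have h5 : |c| * (1 / |c|) < |c| * -besselY n (min ε ε' / 2) :=
      mul_lt_mul_of_pos_left (by linarith) (abs_pos.2 hc0)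
    rw [mul_one_div_cancel (abs_pos.2 hc0).ne'] at h5
    linarith
  filter_upwards [Ioo_mem_nhdsGT hε] with x hx
  have h := hq x hx
  rwa [hc0, div_eq_zero_iff, or_iff_left (hneg x hx.1 hx.2).ne] at h

/-! ### Zeros of the cross-product -/

/-- The positive zeros of `f_n` form a sequence, and the `k`-th of them is located up to `O(x⁻²)`. -/
lemma exists_zeros_crossProduct {r R : ℝ} (hr : 0 < r) (hrR : r < R) (n : ℕ) :
    ∃ x : ℕ → ℝ, IsPosZeroSeq (crossProduct r R n) x ∧ Tendsto x atTop atTop ∧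
      ∃ D : ℝ, ∀ k, 1 ≤ k → 1 ≤ x k →
        |k * π - (R - r) * x k - ((n : ℝ) ^ 2 - 1 / 4) / 2 * (1 / R - 1 / r) / x k| ≤
          D / x k ^ 2 := by
  obtain ⟨W, h⟩ := exists_isFundamentalPair n
  have hR : 0 < R := hr.trans hrR
  obtain ⟨D, hD0, hD⟩ := h.abs_prueferAngle_sub_le hr hrR
  obtain ⟨ε, hε, hneg⟩ := exists_besselY_lt n 0
  set φ : ℝ → ℝ := fun x => prueferAngle n W (besselJ n) (besselJDeriv n) (besselY n)
    (besselYDeriv n) (r * x) (R * x) with hφ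
  have hsmall : ∀ x, 0 < x → x < ε / R → 0 < φ x ∧ φ x < π := by
    intro x hx hxε
    rw [lt_div_iff₀ hR] at hxε
    have hlt : r * x < R * x := mul_lt_mul_of_pos_right hrR hx
    exact ⟨h.prueferAngle_pos (mul_pos hr hx) hlt, h.prueferAngle_lt_pi (mul_pos hr hx) hlt
      fun t ht => (hneg t ((mul_pos hr hx).trans_le ht.1) (by linarith [ht.2])).ne⟩
  have htop : Tendsto φ atTop atTop := by
    set c := ((n : ℝ) ^ 2 - 1 / 4) / 2 * (1 / R - 1 / r)
    refine tendsto_atTop_mono' (f₁ := fun x => (R - r) * x - (|c| + D)) _ ?_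
      (tendsto_atTop_add_const_right _ _ (tendsto_id.const_mul_atTop (sub_pos.2 hrR)))
    filter_upwards [eventually_ge_atTop 1] with x hx
    have h1 := (abs_le.1 (hD x hx)).1
    have h2 : D / x ^ 2 ≤ D := div_le_self hD0 (one_le_pow₀ hx)
    have h3 : -|c| ≤ c / x := by
      have h4 : |c / x| ≤ |c| := by
        rw [abs_div, abs_of_pos (by linarith : 0 < x)]
        exact div_le_self (abs_nonneg _) hx
      exact (neg_le_neg h4).trans (neg_abs_le _)
    linarith
  obtain ⟨x, hmono, himage, hxk, hxtop⟩ := exists_enumeration_of_upcrossing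
    (h.continuousOn_prueferAngle hr hrR)
    (fun x₀ hx₀ k hk => h.prueferAngle_upcrossing hr hrR hx₀ hk) (div_pos hε hR) hsmall htop
  refine ⟨x, ⟨hmono, himage.trans ?_⟩, hxtop, D, fun k hk hx1 => ?_⟩
  · ext t
    refine and_congr_right fun ht => ?_
    rw [← h.kernel_eq_zero_iff (mul_pos hr ht) (mul_pos hR ht), kernel, div_eq_zero_iff,
      or_iff_left h.ne_zero, crossProduct, sub_eq_zero, sub_eq_zero, eq_comm]
  · have := hD (x k) hx1
    rwa [hxk k hk] at this

/-- For large `x`, where `ν / x` is in the range of the first formula for `G`, the linear terms of `g` at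
`0` cancel between the two summands of `G`. -/
lemma GFun_expansion {r R : ℝ} (hr : 0 < r) (hrR : r < R) {ν x : ℝ} (hν : 0 ≤ ν) (hx : 0 < x)
    (hνx : ν / x ≤ r / 2) :
    |π * (x * GFun r R (ν / x)) - ((R - r) * x + ν ^ 2 / 2 * (1 / R - 1 / r) / x)| ≤
      8 * ν ^ 3 * (1 / R ^ 2 + 1 / r ^ 2) / x ^ 2 := by
  have hR : 0 < R := hr.trans hrR
  have hexp : ∀ ρ, 0 < ρ → ν / x ≤ ρ / 2 →
      |π * (x * (ρ * gFun (ν / x / ρ))) - (ρ * x - π / 2 * ν + ν ^ 2 / 2 * (1 / ρ) / x)| ≤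
        8 * ν ^ 3 * (1 / ρ ^ 2) / x ^ 2 := by
    intro ρ hρ hle
    have h := gFun_expansion (u := ν / x / ρ) (by positivity)
      (by rw [div_le_iff₀ hρ]; linarith)
    have e1 : π * (x * (ρ * gFun (ν / x / ρ))) - (ρ * x - π / 2 * ν + ν ^ 2 / 2 * (1 / ρ) / x) =
        (x * ρ) * (π * gFun (ν / x / ρ) -
          (1 - π / 2 * (ν / x / ρ) + (ν / x / ρ) ^ 2 / 2)) := by
      field_simp
    have e2 : 8 * ν ^ 3 * (1 / ρ ^ 2) / x ^ 2 = (x * ρ) * (8 * (ν / x / ρ) ^ 3) := by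
      field_simp
    rw [e1, e2, abs_mul, abs_of_pos (mul_pos hx hρ)]
    exact mul_le_mul_of_nonneg_left h (mul_pos hx hρ).le
  have h1 := hexp R hR (by linarith)
  have h2 := hexp r hr hνx
  rw [GFun, if_pos (by linarith)]
  have e3 : π * (x * (R * gFun (ν / x / R) - r * gFun (ν / x / r))) -
      ((R - r) * x + ν ^ 2 / 2 * (1 / R - 1 / r) / x) =
      (π * (x * (R * gFun (ν / x / R))) - (R * x - π / 2 * ν + ν ^ 2 / 2 * (1 / R) / x)) -
      (π * (x * (r * gFun (ν / x / r))) - (r * x - π / 2 * ν + ν ^ 2 / 2 * (1 / r) / x)) := by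
    ring
  rw [e3, mul_add, add_div]
  exact (abs_sub _ _).trans (add_le_add h1 h2)

/-- For a fixed order the error bound holds eventually, with a constant that does not depend on the
order. -/
lemma eventually_abs_sub_le {r R : ℝ} (hr : 0 < r) (hrR : r < R) {n : ℕ} {x : ℕ → ℝ}
    (hx : Tendsto x atTop atTop) {D : ℝ}
    (hD : ∀ k, 1 ≤ k → 1 ≤ x k →
      |k * π - (R - r) * x k - ((n : ℝ) ^ 2 - 1 / 4) / 2 * (1 / R - 1 / r) / x k| ≤
        D / x k ^ 2) :
    ∀ᶠ k : ℕ in atTop, (n : ℝ) / x k ≤ R ∧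
      |x k * GFun r R (n / x k) - k| ≤ (1 / r - 1 / R) / x k := by
  have hc : 0 < 1 / r - 1 / R := sub_pos.2 (one_div_lt_one_div_of_lt hr hrR)
  set c := 1 / r - 1 / R with hcdef
  set D' := D + 8 * (n : ℝ) ^ 3 * (1 / R ^ 2 + 1 / r ^ 2) with hD'
  filter_upwards [eventually_ge_atTop 1, hx.eventually_ge_atTop 1,
    hx.eventually_ge_atTop (n / (r / 2)), hx.eventually_ge_atTop (D' / c)] with k hk h1 h2 h3
  have hx0 : 0 < x k := by linarith
  have hn : (n : ℝ) / x k ≤ r / 2 := by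
    rw [div_le_iff₀ (by positivity)] at h2
    rw [div_le_iff₀ hx0]
    linarith
  refine ⟨by linarith, ?_⟩
  have hG := GFun_expansion hr hrR (Nat.cast_nonneg n) hx0 hn
  have hK := hD k hk h1
  set A := π * (x k * GFun r R (n / x k)) -
    ((R - r) * x k + (n : ℝ) ^ 2 / 2 * (1 / R - 1 / r) / x k)
  set B := k * π - (R - r) * x k - ((n : ℝ) ^ 2 - 1 / 4) / 2 * (1 / R - 1 / r) / x k
  -- The two coefficients of `1 / x` differ by `(n² / 2 - (n² - 1/4) / 2) (1 / R - 1 / r) = -c / 8`.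
  have hAB : π * (x k * GFun r R (n / x k) - k) = A - B - c / 8 / x k := by
    simp only [A, B, hcdef]
    ring
  have hsum : |A - B - c / 8 / x k| ≤ D' / x k ^ 2 + c / 8 / x k := by
    refine (abs_sub _ _).trans (add_le_add ((abs_sub _ _).trans ?_) (abs_of_pos (by positivity)).le)
    rw [hD', add_div, add_comm (D / _)]
    exact add_le_add hG hK
  have hD'x : D' / x k ^ 2 ≤ c / x k := by
    rw [div_le_iff₀ hc] at h3
    rw [div_le_div_iff₀ (by positivity) hx0]
    nlinarith
  rw [← hAB, abs_mul, abs_of_pos pi_pos] at hsum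
  have hle : c / 8 / x k ≤ c / x k := by
    gcongr
    linarith
  nlinarith [pi_gt_three, abs_nonneg (x k * GFun r R (n / x k) - k)]

end BesselCross

theorem mainTheorem8 (r R : ℝ) (hr : 0 < r) (hrR : r < R) :
    ∃ x : ℕ → ℕ → ℝ,
      (∀ n : ℕ, BesselCross.IsPosZeroSeq (BesselCross.crossProduct r R n) (x n)) ∧
      ∃ C : ℝ, 0 < C ∧ ∀ N : ℕ, ∃ K : ℕ, 0 < K ∧ ∀ n k : ℕ, n ≤ N → K ≤ k →
        (n : ℝ) / x n k ≤ R ∧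
        |x n k * BesselCross.GFun r R ((n : ℝ) / x n k) - (k : ℝ)| ≤ C / x n k := by
  choose x hzero htop D hD using BesselCross.exists_zeros_crossProduct hr hrR
  refine ⟨x, hzero, 1 / r - 1 / R, sub_pos.2 (one_div_lt_one_div_of_lt hr hrR), fun N => ?_⟩
  have hall := (Finset.eventually_all (Finset.range (N + 1))).2 fun n _ =>
    BesselCross.eventually_abs_sub_le hr hrR (htop n) (hD n)
  obtain ⟨K, hK⟩ := Filter.eventually_atTop.1 hall
  exact ⟨K + 1, K.succ_pos, fun n k hn hk =>
    hK k (by omega) n (Finset.mem_range.2 (by omega))⟩
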